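/- Let $\mathrm{Root}_k[p]$ denote the $k$-th real root, in increasing order, of the real polynomial $p$, and put $$\mu_1=\tfrac16\sqrt{\mathrm{Root}_1[-356+312x-66x^2+3x^3]}\approx 0.21821,\qquad \mu_2=\mathrm{Root}_1[-1+432x^2+2592x^3]\approx-0.14937,$$ $$\mu_3=\tfrac16,\qquad \mu_4=\mathrm{Root}_2[1-6x+18x^3]\approx 0.18595,$$ where each $\approx$ means that the two sides differ by less than $10^{-5}$ and the radicand in $\mu_1$ is non-negative. Then the Hermitian matrix $$X=(x_{ij})=\frac13\begin{pmatrix} \frac12&0&-i\mu_1&i\mu_3&i\mu_4&0\\ 0&\frac12&-i\mu_1&-i\mu_4&-(2+i)\mu_3&0\\ i\mu_1&i\mu_1&\frac12&0&0&2\mu_2+i\mu_3\\ -i\mu_3&i\mu_4&0&\frac12&0&-i\mu_1\\ -i\mu_4&(i-2)\mu_3&0&0&\frac12&i\mu_1\\ 0&0&2\mu_2-i\mu_3&i\mu_1&-i\mu_1&\frac12\end{pmatrix}$$ is positive semidefinite of rank $4$. Moreover, a *channel* on $\mathcal M_3$ (the complex $3\times3$ matrices) being a completely positive trace-preserving linear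 map $\mathcal M_3\to\mathcal M_3$, *unital* if it maps $\mathbb 1$ to $\mathbb 1$, there is a unital channel $T$ on $\mathcal M_3$ such that: 1. its Jamiołkowski state is $(\mathrm{id}\otimes T)(|\Omega\rangle\langle\Omega|)=\sum_{i,j=1}^6x_{ij}|\psi_i\rangle\langle\psi_j|$, where $|\Omega\rangle=\frac1{\sqrt3}\sum_{j=1}^3|jj\rangle$ and $$\psi_1=\tfrac1{\sqrt2}(|12\rangle+|21\rangle),\quad \psi_2=\tfrac1{\sqrt2}(|13\rangle+|31\rangle),\quad \psi_3=\tfrac1{\sqrt2}(|23\rangle+|32\rangle),$$ $$\psi_4=\tfrac1{\sqrt2\,i}(|12\rangle-|21\rangle),\quad \psi_5=\tfrac1{\sqrt2\,i}(|13\rangle-|31\rangle),\quad \psi_6=\tfrac1{\sqrt2\,i}(|23\rangle-|32\rangle);$$ 2. $T(\rho)=\sum_{k=1}^4A_k\rho A_k^\dagger$ with $\sum_kA_k^\dagger A_k=\mathbb 1$ for four linearly independent matrices $A_1,\dots,A_4\in\mathcal M_3$ such that the family $\{A_k^\dagger A_l\oplus A_lA_k^\dagger\}_{k,l=1,\dots,4}$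 is linearly independent over $\mathbb C$; 3. $T$ is an extreme point of the convex set of unital channels on $\mathcal M_3$, but not an extreme point of the convex set of all channels on $\mathcal M_3$. -/

import Mathlib

open scoped ComplexOrder

noncomputable section

namespace UnitalChannel

open Matrix Polynomial

/-- The algebra `M_d` of complex `d × d` matrices. -/
abbrev Mat (d : ℕ) : Type := Matrix (Fin d) (Fin d) ℂ

/-- The map `id_n ⊗ T` on `M_n ⊗ M_d`, which applies `T` to each `d × d` block. -/
def ampliation {d : ℕ} (n : ℕ) (T : Mat d →ₗ[ℂ] Mat d)
    (M : Matrix (Fin n × Fin d) (Fin n × Fin d) ℂ) :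
    Matrix (Fin n × Fin d) (Fin n × Fin d) ℂ :=
  Matrix.of fun p q => T (Matrix.of fun a b => M (p.1, a) (q.1, b)) p.2 q.2

/-- Complete positivity: `id_n ⊗ T` preserves positive semidefiniteness for every `n`. -/
def IsCompletelyPositive {d : ℕ} (T : Mat d →ₗ[ℂ] Mat d) : Prop :=
  ∀ (n : ℕ) (M : Matrix (Fin n × Fin d) (Fin n × Fin d) ℂ),
    M.PosSemidef → (ampliation n T M).PosSemidef

/-- The set of quantum channels on `M_d`: completely positive trace preserving linear maps. -/
def channels (d : ℕ) : Set (Mat d →ₗ[ℂ] Mat d) :=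
  {T | IsCompletelyPositive T ∧ ∀ ρ, (T ρ).trace = ρ.trace}

/-- The set of unital quantum channels on `M_d`. -/
def unitalChannels (d : ℕ) : Set (Mat d →ₗ[ℂ] Mat d) :=
  {T | T ∈ channels d ∧ T 1 = 1}

/-- `T(ρ) = ∑ i, A_i ρ A_i†` with `∑ i, A_i† A_i = 1`. -/
def IsKrausDecomposition {d N : ℕ} (T : Mat d →ₗ[ℂ] Mat d) (A : Fin N → Mat d) : Prop :=
  (∀ ρ, T ρ = ∑ i, A i * ρ * (A i)ᴴ) ∧ ∑ i, (A i)ᴴ * A i = 1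

/-- The product basis vector `|jk⟩`. -/
def ket {d : ℕ} (j k : Fin d) : Fin d × Fin d → ℂ := Pi.single (j, k) 1

/-- The rank one operator `|v⟩⟨w|`. -/
def ketBra {ι : Type*} (v w : ι → ℂ) : Matrix ι ι ℂ := vecMulVec v (star w)

/-- The maximally entangled vector `|Ω⟩ = d^{-1/2} ∑ j, |jj⟩`. -/
def maxEntangled (d : ℕ) : Fin d × Fin d → ℂ :=
  (1 / ((Real.sqrt d : ℝ) : ℂ)) • ∑ j : Fin d, ket j j

/-- The Jamiolkowski state `ρ_T = (id ⊗ T)(|Ω⟩⟨Ω|)`. -/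
def jamiolkowski {d : ℕ} (T : Mat d →ₗ[ℂ] Mat d) :
    Matrix (Fin d × Fin d) (Fin d × Fin d) ℂ :=
  ampliation d T (ketBra (maxEntangled d) (maxEntangled d))

/-- The orthonormal basis `ψ_1, …, ψ_6` of the orthogonal complement of the `|kk⟩` in `ℂ³ ⊗ ℂ³`. -/
def psi : Fin 6 → (Fin 3 × Fin 3 → ℂ) :=
  ![(1 / ((Real.sqrt 2 : ℝ) : ℂ)) • (ket 0 1 + ket 1 0),
    (1 / ((Real.sqrt 2 : ℝ) : ℂ)) • (ket 0 2 + ket 2 0),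
    (1 / ((Real.sqrt 2 : ℝ) : ℂ)) • (ket 1 2 + ket 2 1),
    (1 / (((Real.sqrt 2 : ℝ) : ℂ) * Complex.I)) • (ket 0 1 - ket 1 0),
    (1 / (((Real.sqrt 2 : ℝ) : ℂ) * Complex.I)) • (ket 0 2 - ket 2 0),
    (1 / (((Real.sqrt 2 : ℝ) : ℂ) * Complex.I)) • (ket 1 2 - ket 2 1)]

open Complex in
/-- The Hermitian matrix `X` of the Ansatz, as a function of the four real parameters. -/
def matX (μ₁ μ₂ μ₃ μ₄ : ℝ) : Matrix (Fin 6) (Fin 6) ℂ :=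
  (1 / 3 : ℂ) • !![
    1 / 2, 0, -I * μ₁, I * μ₃, I * μ₄, 0;
    0, 1 / 2, -I * μ₁, -I * μ₄, -(2 + I) * μ₃, 0;
    I * μ₁, I * μ₁, 1 / 2, 0, 0, 2 * μ₂ + I * μ₃;
    -I * μ₃, I * μ₄, 0, 1 / 2, 0, -I * μ₁;
    -I * μ₄, (I - 2) * μ₃, 0, 0, 1 / 2, I * μ₁;
    0, 0, 2 * μ₂ - I * μ₃, I * μ₁, -I * μ₁, 1 / 2]

/-- `x` is the `k`-th real root of `p ≠ 0` in increasing order, counting from `k = 1`. -/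
def IsNthRealRoot (k : ℕ) (p : ℝ[X]) (x : ℝ) : Prop :=
  p ≠ 0 ∧ p.IsRoot x ∧ (p.roots.filter (· < x)).card + 1 = k

/-- The four explicit algebraic numbers. -/
def IsSpecialParameters (μ₁ μ₂ μ₃ μ₄ : ℝ) : Prop :=
  (∃ r : ℝ, IsNthRealRoot 1 (-356 + 312 * X - 66 * X ^ 2 + 3 * X ^ 3) r ∧
    0 ≤ r ∧ μ₁ = 1 / 6 * Real.sqrt r) ∧
  IsNthRealRoot 1 (-1 + 432 * X ^ 2 + 2592 * X ^ 3) μ₂ ∧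
  μ₃ = 1 / 6 ∧
  IsNthRealRoot 2 (1 - 6 * X + 18 * X ^ 3) μ₄

end UnitalChannel

end

/-! Everything is governed by one root `y` of `y³ - 12y + 12`: with `m² = 2 - y + 2y²/3` the
parameters are `μ₁ = m/6`, `μ₄ = y/6`, and `μ₂` is a quadratic polynomial in `y`. The Choi matrix
lives on the six product vectors `|jk⟩`, `j ≠ k`. Conjugation by a diagonal matrix of phases and
powers of `m` turns this block into a real matrix over `ℚ(y)`, which is a sum of four rank one terms
with positive weights. These terms are the four Kraus operators; read in the basis `psi` they factor
`X` as `B * Bᴴ`, which gives positivity and rank.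

The heart is a rigidity statement, `eq_zero_of_marginals_of_kernel`: a matrix on `ℂ³ ⊗ ℂ³` whose
rows and columns are orthogonal to the kernel of the Choi matrix and whose two partial traces vanish
is zero. In cyclic order on the six vectors, vanishing partial traces make the diagonal alternate in
sign and kill all neighbouring entries; the kernel conditions then leave a nonsingular linear system
over `ℚ(y)`. Rigidity is used twice: for the sesquilinear combinations behind the independence of
the products, and for the difference of Choi matrices of two unital channels, which gives
extremality.

Among all channels extremality fails by counting: the 16 products of Kraus operators lie in a space
of dimension 9. -/

open scoped ComplexOrder

noncomputable section

namespace UnitalChannel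

open Matrix

/-! ### Kraus forms, Choi matrices and the perturbation argument for extremality. -/

section Choi

open scoped MatrixOrder Matrix.Norms.L2Operator

variable {d : ℕ} {ι : Type*} [Fintype ι]

/-- The map `ρ ↦ ∑ k l, g k l • A k * ρ * (A l)†`. -/
def krausForm (A : ι → Mat d) (g : Matrix ι ι ℂ) : Mat d →ₗ[ℂ] Mat d :=
  ∑ k, ∑ l, g k l • LinearMap.mulLeftRight ℂ (A k, (A l)ᴴ)

theorem krausForm_apply (A : ι → Mat d) (g : Matrix ι ι ℂ) (ρ : Mat d) :
    krausForm A g ρ = ∑ k, ∑ l, g k l • (A k * ρ * (A l)ᴴ) := by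
  simp [krausForm, LinearMap.sum_apply]

theorem krausForm_one_apply [DecidableEq ι] (A : ι → Mat d) (ρ : Mat d) :
    krausForm A 1 ρ = ∑ k, A k * ρ * (A k)ᴴ := by
  simp [krausForm_apply, Matrix.one_apply, ite_smul]

theorem krausForm_add (A : ι → Mat d) (g h : Matrix ι ι ℂ) :
    krausForm A (g + h) = krausForm A g + krausForm A h := by
  simp [krausForm, add_smul, Finset.sum_add_distrib]

theorem krausForm_smul (A : ι → Mat d) (c : ℂ) (g : Matrix ι ι ℂ) :
    krausForm A (c • g) = c • krausForm A g := by
  simp [krausForm, mul_smul, Finset.smul_sum]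

/-- A factorization `g = Bᴴ * B` mixes the `A k` into genuine Kraus operators, so positive
semidefinite coefficients give completely positive maps. -/
theorem krausForm_conjTranspose_mul_self (A : ι → Mat d) (B : Matrix ι ι ℂ) (ρ : Mat d) :
    krausForm A (Bᴴ * B) ρ =
      ∑ m, (∑ k, star (B m k) • A k) * ρ * (∑ l, star (B m l) • A l)ᴴ := by
  have h : ∀ m : ι, (∑ k, star (B m k) • A k) * ρ * (∑ l, star (B m l) • A l)ᴴ =
      ∑ k, ∑ l, (star (B m k) * B m l) • (A k * ρ * (A l)ᴴ) := by
    intro m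
    simp only [conjTranspose_sum, conjTranspose_smul, star_star, Finset.sum_mul, Finset.mul_sum,
      smul_mul_assoc, mul_smul_comm, Finset.smul_sum, smul_smul]
    rw [Finset.sum_comm]
    simp only [mul_comm (B m _)]
  simp only [krausForm_apply, h, Matrix.mul_apply, conjTranspose_apply, Finset.sum_smul]
  rw [Finset.sum_comm (s := Finset.univ (α := ι)) (t := Finset.univ (α := ι))
    (f := fun m k => ∑ l, (star (B m k) * B m l) • (A k * ρ * (A l)ᴴ))]
  exact Finset.sum_congr rfl fun k _ => Finset.sum_comm

theorem ampliation_conj (n : ℕ) (T : Mat d →ₗ[ℂ] Mat d) (C : ι → Mat d)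
    (hT : ∀ ρ, T ρ = ∑ m, C m * ρ * (C m)ᴴ) (M : Matrix (Fin n × Fin d) (Fin n × Fin d) ℂ) :
    ampliation n T M =
      ∑ m, (Matrix.kronecker (1 : Matrix (Fin n) (Fin n) ℂ) (C m)) * M *
        (Matrix.kronecker (1 : Matrix (Fin n) (Fin n) ℂ) (C m))ᴴ := by
  ext ⟨i, a⟩ ⟨j, b⟩
  simp only [ampliation, hT, Matrix.sum_apply, Matrix.of_apply]
  refine Finset.sum_congr rfl fun m _ => ?_
  simp [Matrix.mul_apply, Fintype.sum_prod_type, Matrix.one_apply, Matrix.kronecker,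
    apply_ite (starRingEnd ℂ), mul_ite, Finset.sum_ite_irrel]

theorem isCompletelyPositive_of_kraus (T : Mat d →ₗ[ℂ] Mat d) (C : ι → Mat d)
    (hT : ∀ ρ, T ρ = ∑ m, C m * ρ * (C m)ᴴ) : IsCompletelyPositive T := by
  intro n M hM
  rw [ampliation_conj n T C hT]
  exact posSemidef_sum _ fun m _ => hM.mul_mul_conjTranspose_same _

theorem isCompletelyPositive_krausForm (A : ι → Mat d) {g : Matrix ι ι ℂ} (hg : g.PosSemidef) :
    IsCompletelyPositive (krausForm A g) := by
  classical
  obtain ⟨B, rfl⟩ := CStarAlgebra.nonneg_iff_eq_star_mul_self.mp hg.nonneg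
  exact isCompletelyPositive_of_kraus _ _ (krausForm_conjTranspose_mul_self A B)

/-- The Choi matrix of `T`, the unnormalised Jamiolkowski state. -/
def choi (T : Mat d →ₗ[ℂ] Mat d) : Matrix (Fin d × Fin d) (Fin d × Fin d) ℂ :=
  Matrix.of fun p q => T (Matrix.single p.1 q.1 1) p.2 q.2

theorem jamiolkowski_eq_choi (T : Mat d →ₗ[ℂ] Mat d) :
    jamiolkowski T = (1 / (d : ℂ)) • choi T := by
  have hs : ((Real.sqrt d : ℝ) : ℂ) * ((Real.sqrt d : ℝ) : ℂ) = d := by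
    rw [← Complex.ofReal_mul, Real.mul_self_sqrt (Nat.cast_nonneg d), Complex.ofReal_natCast]
  have hv : ∀ i a, maxEntangled d (i, a) =
      (1 / ((Real.sqrt d : ℝ) : ℂ)) * if i = a then 1 else 0 := by
    intro i a
    have : ∀ j : Fin d, ket j j (i, a) = if j = i then (if i = a then (1 : ℂ) else 0) else 0 := by
      intro j
      simp only [ket, Pi.single_apply, Prod.mk.injEq]
      split_ifs <;> simp_all
    simp [maxEntangled, Finset.sum_apply, this]
  ext ⟨i, a⟩ ⟨j, b⟩
  have : (Matrix.of fun a b => ketBra (maxEntangled d) (maxEntangled d) (i, a) (j, b)) =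
      (1 / (d : ℂ)) • (Matrix.single i j 1 : Mat d) := by
    ext a b
    simp only [Matrix.of_apply, ketBra, vecMulVec_apply, Pi.star_apply, hv, Matrix.smul_apply,
      Matrix.single_apply, smul_eq_mul]
    by_cases h1 : i = a <;> by_cases h2 : j = b <;> simp [h1, h2, ← hs]
  simp only [jamiolkowski, ampliation, Matrix.of_apply, this, map_smul, choi, Matrix.smul_apply]

/-- Complete positivity is tested on the maximally entangled projector alone; `d = 0` is separate
because of the normalisation `1 / d`. -/
theorem posSemidef_choi {T : Mat d →ₗ[ℂ] Mat d} (hT : IsCompletelyPositive T) :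
    (choi T).PosSemidef := by
  rcases Nat.eq_zero_or_pos d with rfl | hd
  · have : choi T = 0 := by ext ⟨i, _⟩; exact i.elim0
    rw [this]; exact PosSemidef.zero
  have h := hT d _ (posSemidef_vecMulVec_self_star (maxEntangled d))
  have h2 : choi T = (d : ℂ) • jamiolkowski T := by
    rw [jamiolkowski_eq_choi, smul_smul, mul_one_div_cancel (by exact_mod_cast hd.ne'), one_smul]
  rw [h2]
  exact PosSemidef.smul h (by positivity)

theorem choi_injective : Function.Injective (choi (d := d)) := by
  intro S T h
  refine Matrix.ext_linearMap ℂ fun i j => ?_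
  refine LinearMap.ext_ring ?_
  ext a b
  exact congrFun (congrFun h (i, a)) (j, b)

theorem choi_krausForm (A : ι → Mat d) (g : Matrix ι ι ℂ) (p q : Fin d × Fin d) :
    choi (krausForm A g) p q = ∑ k, ∑ l, g k l * (A k p.2 p.1 * star (A l q.2 q.1)) := by
  simp [choi, krausForm_apply, Matrix.sum_apply, Matrix.mul_apply, Matrix.single_apply,
    ite_and]

theorem choi_add (S T : Mat d →ₗ[ℂ] Mat d) : choi (S + T) = choi S + choi T := rfl

theorem choi_real_smul (c : ℝ) (T : Mat d →ₗ[ℂ] Mat d) : choi (c • T) = c • choi T := rfl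

/-- Trace preservation fixes the partial trace over the output slot, and unitality the one over the
input slot, so differences of unital channels have vanishing marginals. -/
theorem sum_choi_of_trace {T : Mat d →ₗ[ℂ] Mat d} (hT : ∀ ρ, (T ρ).trace = ρ.trace)
    (i j : Fin d) : ∑ a, choi T (i, a) (j, a) = if i = j then 1 else 0 := by
  have := hT (Matrix.single i j 1)
  simp only [Matrix.trace, Matrix.diag_apply, Matrix.single_apply] at this
  simp only [choi, Matrix.of_apply]
  rw [this]
  by_cases h : i = j <;> simp [h, ite_and, eq_comm]

theorem sum_choi_of_map_one {T : Mat d →ₗ[ℂ] Mat d} (hT : T 1 = 1) (a b : Fin d) :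
    ∑ i, choi T (i, a) (i, b) = if a = b then 1 else 0 := by
  have h1 : (1 : Mat d) = ∑ i, Matrix.single i i 1 := by
    ext a b
    simp [Matrix.sum_apply, Matrix.single_apply, Matrix.one_apply, ite_and]
  rw [← Matrix.one_apply, ← hT]
  conv_rhs => rw [h1, map_sum, Matrix.sum_apply]
  rfl

/-- Sesquilinear combinations of a linearly independent family vanish only trivially. -/
theorem eq_zero_of_sum_mul_star_eq_zero {A : ι → Mat d} (hA : LinearIndependent ℂ A)
    {g : Matrix ι ι ℂ}
    (h : ∀ p q : Fin d × Fin d, ∑ k, ∑ l, g k l * (A k p.2 p.1 * star (A l q.2 q.1)) = 0) :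
    g = 0 := by
  have key := Fintype.linearIndependent_iff.mp hA
  have h1 : ∀ (q : Fin d × Fin d) k, ∑ l, g k l * star (A l q.2 q.1) = 0 := by
    intro q
    refine key _ ?_
    ext a b
    rw [Matrix.sum_apply, Matrix.zero_apply, ← h (b, a) q]
    refine Finset.sum_congr rfl fun k _ => ?_
    rw [Matrix.smul_apply, smul_eq_mul, Finset.sum_mul]
    exact Finset.sum_congr rfl fun l _ => by ring
  ext k l
  have h2 := key (fun l => star (g k l)) (by
    ext a b
    rw [Matrix.sum_apply, Matrix.zero_apply, ← star_zero, ← h1 (b, a) k, star_sum]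
    refine Finset.sum_congr rfl fun l _ => ?_
    simp [mul_comm])
  simpa using h2 l

variable [DecidableEq ι]

/-- A channel with linearly independent Kraus operators `A k` is not extreme among all channels
if there are more than `d ^ 2` products `(A l)† * A k`. -/
theorem notMem_extremePoints_channels {A : ι → Mat d} (hA : LinearIndependent ℂ A)
    (hA1 : ∑ k, (A k)ᴴ * A k = 1) (hd : d < Fintype.card ι) :
    krausForm A 1 ∉ Set.extremePoints ℝ (channels d) := by
  let Φ : Matrix ι ι ℂ →ₗ[ℂ] Mat d :=
    { toFun := fun g => ∑ k, ∑ l, g k l • ((A l)ᴴ * A k)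
      map_add' := fun g h => by simp [add_smul, Finset.sum_add_distrib]
      map_smul' := fun c g => by simp [mul_smul, Finset.smul_sum] }
  have hΦ : ∀ g, Φ g = ∑ k, ∑ l, g k l • ((A l)ᴴ * A k) := fun g => rfl
  have htr : ∀ g ρ, (krausForm A g ρ).trace = (Φ g * ρ).trace := by
    intro g ρ
    simp only [krausForm_apply, hΦ, Matrix.trace_sum, Matrix.trace_smul, Finset.sum_mul,
      smul_mul_assoc]
    refine Finset.sum_congr rfl fun k _ => Finset.sum_congr rfl fun l _ => ?_
    rw [Matrix.trace_mul_comm, ← Matrix.mul_assoc]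
  have hΦ1 : Φ 1 = 1 := by
    rw [hΦ, ← hA1]
    simp [Matrix.one_apply, ite_smul]
  have hstar : ∀ g, Φ gᴴ = (Φ g)ᴴ := by
    intro g
    simp only [hΦ, conjTranspose_sum, conjTranspose_smul, conjTranspose_mul,
      conjTranspose_conjTranspose, conjTranspose_apply]
    exact Finset.sum_comm
  obtain ⟨g, hg, hg0⟩ : ∃ g, Φ g = 0 ∧ g ≠ 0 := by
    have := LinearMap.ker_ne_bot_of_finrank_lt (f := Φ) (by
      simp only [Module.finrank_matrix, Module.finrank_self, Fintype.card_fin, mul_one]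
      exact Nat.mul_lt_mul'' hd hd)
    obtain ⟨g, hg, hg0⟩ := (Submodule.ne_bot_iff _).mp this
    exact ⟨g, hg, hg0⟩
  -- The kernel of `Φ` is stable under `ᴴ`, so it contains `g + gᴴ`; if this vanishes, `g` is
  -- skew-Hermitian and `I • g` serves.
  obtain ⟨h, hh, hh0, hherm⟩ : ∃ h, Φ h = 0 ∧ h ≠ 0 ∧ h.IsHermitian := by
    by_cases hs : g + gᴴ = 0
    · refine ⟨Complex.I • g, by rw [map_smul, hg, smul_zero], by simpa using hg0, ?_⟩
      rw [IsHermitian, conjTranspose_smul, eq_neg_of_add_eq_zero_right hs]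
      simp
    · exact ⟨g + gᴴ, by rw [map_add, hstar, hg]; simp, hs, isHermitian_add_transpose_self g⟩
  -- Since `-‖h‖ ≤ h ≤ ‖h‖` in operator norm, `c = ‖h‖⁻¹` works for both signs.
  obtain ⟨c, hc, hpos, hneg⟩ : ∃ c : ℝ, 0 < c ∧ (1 + (c : ℂ) • h).PosSemidef ∧
      (1 + (-(c : ℂ)) • h).PosSemidef := by
    have hpos : 0 < ‖h‖ := norm_pos_iff.mpr hh0
    have hsa : IsSelfAdjoint h := hherm
    have e1 : (1 : Matrix ι ι ℂ) + ((‖h‖⁻¹ : ℝ) : ℂ) • h =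
        ((‖h‖⁻¹ : ℝ) : ℂ) • (h - -(algebraMap ℝ (Matrix ι ι ℂ) ‖h‖)) := by
      have hne : ((‖h‖ : ℝ) : ℂ) ≠ 0 := by exact_mod_cast hpos.ne'
      ext i j
      simp [Algebra.algebraMap_eq_smul_one, Matrix.smul_apply, mul_add, hne]
      ring
    have e2 : (1 : Matrix ι ι ℂ) + (-((‖h‖⁻¹ : ℝ) : ℂ)) • h =
        ((‖h‖⁻¹ : ℝ) : ℂ) • (algebraMap ℝ (Matrix ι ι ℂ) ‖h‖ - h) := by
      have hne : ((‖h‖ : ℝ) : ℂ) ≠ 0 := by exact_mod_cast hpos.ne'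
      ext i j
      simp [Algebra.algebraMap_eq_smul_one, Matrix.smul_apply, mul_sub, hne]
      ring
    have hc : (0 : ℂ) ≤ ((‖h‖⁻¹ : ℝ) : ℂ) := by
      rw [Complex.zero_le_real]; positivity
    refine ⟨‖h‖⁻¹, inv_pos.mpr hpos, ?_, ?_⟩
    · rw [e1]
      exact PosSemidef.smul (Matrix.le_iff.mp hsa.neg_algebraMap_norm_le_self) hc
    · rw [e2]
      exact PosSemidef.smul (Matrix.le_iff.mp hsa.le_algebraMap_norm_self) hc
  have hmem : ∀ c : ℂ, (1 + c • h).PosSemidef → krausForm A (1 + c • h) ∈ channels d := by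
    intro c hc
    refine ⟨isCompletelyPositive_krausForm A hc, fun ρ => ?_⟩
    rw [htr, map_add, map_smul, hh, hΦ1, smul_zero, add_zero, one_mul]
  intro hext
  have := (mem_extremePoints.mp hext).2 _ (hmem _ hpos) _ (hmem _ hneg)
    ⟨1 / 2, 1 / 2, by norm_num, by norm_num, by norm_num, by
      simp only [krausForm_add, krausForm_smul]
      module⟩
  have h0 : krausForm A ((c : ℂ) • h) = 0 := by
    have := this.1
    rwa [krausForm_add, add_eq_left] at this
  have hz : (c : ℂ) • h = 0 := eq_zero_of_sum_mul_star_eq_zero hA fun p q => by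
    rw [← choi_krausForm, h0]; rfl
  exact hh0 ((smul_eq_zero.mp hz).resolve_left (by exact_mod_cast hc.ne'))

/-- A matrix annihilated by the positive semidefinite `a • C₁ + b • C₂` is annihilated by `C₁`. -/
theorem mulVec_eq_zero_of_add {n : Type*} [Fintype n] {C₁ C₂ : Matrix n n ℂ}
    (h1 : C₁.PosSemidef) (h2 : C₂.PosSemidef) {a b : ℝ} (ha : 0 < a) (hb : 0 ≤ b) {v : n → ℂ}
    (hv : (a • C₁ + b • C₂) *ᵥ v = 0) : C₁ *ᵥ v = 0 := by
  have hsum : a • (star v ⬝ᵥ C₁ *ᵥ v) + b • (star v ⬝ᵥ C₂ *ᵥ v) = 0 := by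
    rw [← dotProduct_smul, ← dotProduct_smul, ← dotProduct_add, ← smul_mulVec, ← smul_mulVec,
      ← add_mulVec, hv, dotProduct_zero]
  have n1 : 0 ≤ a • (star v ⬝ᵥ C₁ *ᵥ v) := smul_nonneg ha.le (h1.dotProduct_mulVec_nonneg v)
  have n2 : 0 ≤ b • (star v ⬝ᵥ C₂ *ᵥ v) := smul_nonneg hb (h2.dotProduct_mulVec_nonneg v)
  have h0 := (add_eq_zero_iff_of_nonneg n1 n2).mp hsum
  exact (h1.dotProduct_mulVec_zero_iff v).mp ((smul_eq_zero.mp h0.1).resolve_left ha.ne')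

end Choi

/-! ### The four parameters in terms of one cubic root. -/

section Parameters

open Polynomial

/-- The cubic is `12 * (1 - 6x + 18x³)` at `x = y / 6`, that is, the equation of `μ₄`. -/
theorem exists_cubic_root :
    ∃ y : ℝ, y ^ 3 - 12 * y + 12 = 0 ∧ 1.11574 < y ∧ y < 1.11576 := by
  have hc : ContinuousOn (fun y : ℝ => y ^ 3 - 12 * y + 12) (Set.Icc 1.11574 1.11576) := by
    fun_prop
  obtain ⟨y, ⟨h1, h2⟩, h3⟩ := intermediate_value_Ioo' (by norm_num) hc
    (show (0 : ℝ) ∈ Set.Ioo _ _ by constructor <;> norm_num)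
  exact ⟨y, h3, h1, h2⟩

theorem exists_neg_cubic_root : ∃ y : ℝ, y ^ 3 - 12 * y + 12 = 0 ∧ y < 0 := by
  have hc : ContinuousOn (fun y : ℝ => y ^ 3 - 12 * y + 12) (Set.Icc (-4) 0) := by
    fun_prop
  obtain ⟨y, ⟨h1, h2⟩, h3⟩ := intermediate_value_Ioo (by norm_num) hc
    (show (0 : ℝ) ∈ Set.Ioo _ _ by constructor <;> norm_num)
  exact ⟨y, h3, h2⟩

theorem isNthRealRoot_one {p : ℝ[X]} {x : ℝ} (h0 : p.eval x = 0)
    (hlt : ∀ t < x, p.eval t ≠ 0) : IsNthRealRoot 1 p x := by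
  refine ⟨?_, h0, ?_⟩
  · rintro rfl
    exact hlt (x - 1) (by linarith) (by simp)
  · rw [Multiset.filter_eq_nil.mpr]
    · simp
    · intro t ht htx
      exact hlt t htx (isRoot_of_mem_roots ht)

theorem isNthRealRoot_two {a b c k : ℝ} (hk : k ≠ 0) (hab : a < b) (hbc : b < c) :
    IsNthRealRoot 2 (C k * ((X - C a) * (X - C b) * (X - C c))) b := by
  have h0 : (X - C a) * (X - C b) * (X - C c) ≠ 0 :=
    mul_ne_zero (mul_ne_zero (X_sub_C_ne_zero a) (X_sub_C_ne_zero b)) (X_sub_C_ne_zero c)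
  refine ⟨mul_ne_zero (C_ne_zero.mpr hk) h0, by simp, ?_⟩
  rw [roots_C_mul _ hk, roots_mul h0,
    roots_mul (mul_ne_zero (X_sub_C_ne_zero a) (X_sub_C_ne_zero b))]
  simp [Multiset.filter_singleton, hab, hbc.le]

theorem isNthRealRoot_radicand {y : ℝ} (hy : y ^ 3 - 12 * y + 12 = 0)
    (h1 : 1.11574 < y) (h2 : y < 1.11576) :
    IsNthRealRoot 1 (-356 + 312 * X - 66 * X ^ 2 + 3 * X ^ 3 : ℝ[X])
      (2 - y + 2 / 3 * y ^ 2) := by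
  set r := 2 - y + 2 / 3 * y ^ 2 with hr
  have hr1 : r < 2 := by nlinarith
  have hr0 : 0 < r := by nlinarith
  have hroot : -356 + 312 * r - 66 * r ^ 2 + 3 * r ^ 3 = 0 := by
    rw [hr]
    grind
  refine isNthRealRoot_one (by simpa using hroot) fun t ht h => ?_
  have ht' : -356 + 312 * t - 66 * t ^ 2 + 3 * t ^ 3 = 0 := by simpa using h
  -- For `t < r` the quadratic cofactor decreases in `t`, and it is positive at `r` because `r < 2`.
  have : (r - t) * (312 - 66 * (r + t) + 3 * (r ^ 2 + r * t + t ^ 2)) = 0 := by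
    linear_combination hroot - ht'
  rcases mul_eq_zero.mp this with h | h
  · linarith
  · nlinarith [sq_nonneg (r - t), mul_pos (sub_pos.mpr ht) hr0]

theorem isNthRealRoot_mu_two {y : ℝ} (hy : y ^ 3 - 12 * y + 12 = 0)
    (h1 : 1.11574 < y) (h2 : y < 1.11576) :
    IsNthRealRoot 1 (-1 + 432 * X ^ 2 + 2592 * X ^ 3 : ℝ[X]) (-(1 - y ^ 2 / 12) / 6) := by
  set r := -(1 - y ^ 2 / 12) / 6 with hr
  have hr1 : r < -0.149 := by nlinarith
  have hroot : -1 + 432 * r ^ 2 + 2592 * r ^ 3 = 0 := by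
    rw [hr]
    grind
  refine isNthRealRoot_one (by simpa using hroot) fun t ht h => ?_
  have ht' : -1 + 432 * t ^ 2 + 2592 * t ^ 3 = 0 := by simpa using h
  -- The cofactor at `t = r` is `r * (864 + 7776 * r)`, positive for `r < -1/9`; it is larger still
  -- for `t < r`.
  have : (r - t) * (432 * (r + t) + 2592 * (r ^ 2 + r * t + t ^ 2)) = 0 := by
    linear_combination hroot - ht'
  rcases mul_eq_zero.mp this with h | h
  · linarith
  · nlinarith [sq_nonneg (r - t), mul_pos (sub_pos.mpr ht) (show 0 < -r by linarith)]

theorem isNthRealRoot_mu_four {y : ℝ} (hy : y ^ 3 - 12 * y + 12 = 0)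
    (h1 : 1.11574 < y) (h2 : y < 1.11576) :
    IsNthRealRoot 2 (1 - 6 * X + 18 * X ^ 3 : ℝ[X]) (y / 6) := by
  obtain ⟨a, ha, ha0⟩ := exists_neg_cubic_root
  have hsum : a ^ 2 + a * y + y ^ 2 = 12 := by
    have : (y - a) * (a ^ 2 + a * y + y ^ 2 - 12) = 0 := by linear_combination hy - ha
    rcases mul_eq_zero.mp this with h | h <;> linarith
  -- The cubic in `y` has no quadratic term, so its third root is `-a - y`.
  have hp : (1 - 6 * X + 18 * X ^ 3 : ℝ[X]) =
      C 18 * ((X - C (a / 6)) * (X - C (y / 6)) * (X - C ((-a - y) / 6))) := by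
    refine Polynomial.funext fun t => ?_
    simp only [eval_add, eval_sub, eval_mul, eval_pow, eval_X, eval_C, eval_one, eval_ofNat]
    linear_combination t / 2 * hsum + 1 / 12 * (hy - y * hsum)
  rw [hp]
  refine isNthRealRoot_two (by norm_num) (by linarith) ?_
  have : a < -3 := by nlinarith
  linarith

theorem isSpecialParameters_of_root {y : ℝ} (hy : y ^ 3 - 12 * y + 12 = 0)
    (h1 : 1.11574 < y) (h2 : y < 1.11576) :
    IsSpecialParameters (1 / 6 * Real.sqrt (2 - y + 2 / 3 * y ^ 2)) (-(1 - y ^ 2 / 12) / 6)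
      (1 / 6) (y / 6) :=
  ⟨⟨_, isNthRealRoot_radicand hy h1 h2, by nlinarith, rfl⟩, isNthRealRoot_mu_two hy h1 h2, rfl,
    isNthRealRoot_mu_four hy h1 h2⟩

theorem abs_mu_one_sub_lt {y : ℝ} (h1 : 1.11574 < y) (h2 : y < 1.11576) :
    |1 / 6 * Real.sqrt (2 - y + 2 / 3 * y ^ 2) - 0.21821| < 1 / 10 ^ 5 := by
  have l : (1.3092 : ℝ) < Real.sqrt (2 - y + 2 / 3 * y ^ 2) :=
    Real.lt_sqrt_of_sq_lt (by nlinarith)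
  have u : Real.sqrt (2 - y + 2 / 3 * y ^ 2) < 1.3093 := by
    rw [Real.sqrt_lt' (by norm_num)]
    nlinarith
  rw [abs_lt]; constructor <;> norm_num <;> linarith

theorem abs_mu_two_sub_lt {y : ℝ} (h1 : 1.11574 < y) (h2 : y < 1.11576) :
    |-(1 - y ^ 2 / 12) / 6 - (-0.14937)| < 1 / 10 ^ 5 := by
  rw [abs_lt]; constructor <;> norm_num <;> nlinarith

theorem abs_mu_four_sub_lt {y : ℝ} (h1 : 1.11574 < y) (h2 : y < 1.11576) :
    |y / 6 - 0.18595| < 1 / 10 ^ 5 := by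
  rw [abs_lt]; constructor <;> norm_num <;> linarith

end Parameters

/-! ### The linear system over `ℚ(y)` behind rigidity. -/

/-- The diagonal of a matrix on the six off-diagonal product vectors, in cyclic order, all of
whose row and column marginals vanish, after rescaling. -/
def diagPattern {K : Type*} [Field K] (y : K) : Fin 6 → K :=
  ![1, -1, (240 - 10 * y - 17 * y ^ 2) / 356, -1, 1, (-240 + 10 * y + 17 * y ^ 2) / 356]

/-- In row `a` the entries at `a ± 1` vanish and the diagonal one is a multiple of `t`. The two
kernel equations solve for the entries at `a ± 2` in terms of `t` and the antipodal entry at `a +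
3`. The certificates hold modulo the cubic, hence for any of its roots. -/
theorem kernel_row_formulas {K : Type*} [Field K] [CharZero K] {y t : K}
    (hy : y ^ 3 - 12 * y + 12 = 0) {U : Fin 6 → Fin 6 → K}
    (h1 : ∀ a, U a 0 * 2 + U a 1 * (-2 + y) + U a 2 * (-4) + U a 3 * (-2 + y) +
      U a 5 * (8 - 6 * y + y ^ 2) = 0)
    (h2 : ∀ a, U a 0 * 2 + U a 2 * (-4 - 2 * y) + U a 3 * (-4 + 4 * y - y ^ 2) + U a 4 * 2 +
      U a 5 * (16 - 16 * y + 4 * y ^ 2) = 0)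
    (hnext : ∀ a, U a (a + 1) = 0) (hprev : ∀ a, U (a + 1) a = 0)
    (hd : ∀ a, U a a = diagPattern y a * t) :
    U 0 2 = (1 / 2) * t + (-2 + y) / 4 * U 0 3 ∧
    U 0 4 = (y / 2) * t + (4 - 8 * y + 3 * y ^ 2) / 4 * U 0 3 ∧
    U 1 3 = (12 - y ^ 2) / 3 * t + (-48 + 3 * y + 4 * y ^ 2) / 6 * U 1 4 ∧
    U 1 5 = (12 - y ^ 2) / 12 * t + (-15 + y ^ 2) / 6 * U 1 4 ∧
    U 2 4 = (102 + 18 * y - 5 * y ^ 2) / 178 * t + (-8 + 10 * y - 3 * y ^ 2) / 2 * U 2 5 ∧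
    U 2 0 = (240 - 10 * y - 17 * y ^ 2) / 178 * t + (-8 + 6 * y - y ^ 2) / 2 * U 2 5 ∧
    U 3 5 = (-1) / 4 * t + (-4 - y) / 8 * U 3 0 ∧
    U 3 1 = (y / 4) * t + (16 - 8 * y - 3 * y ^ 2) / 8 * U 3 0 ∧
    U 4 0 = (12 - y ^ 2) / 6 * t + (12 - 3 * y - y ^ 2) / 6 * U 4 1 ∧
    U 4 2 = (12 - y ^ 2) / 12 * t + (6 - y ^ 2) / 12 * U 4 1 ∧
    U 5 1 = (102 + 18 * y - 5 * y ^ 2) / 178 * t + (-8 + 10 * y + 3 * y ^ 2) / 2 * U 5 2 ∧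
    U 5 3 = (-240 + 10 * y + 17 * y ^ 2) / 89 * t + (-8 - 6 * y - y ^ 2) / 2 * U 5 2 := by
  have n0 := hnext 0
  have n1 := hnext 1
  have n2 := hnext 2
  have n3 := hnext 3
  have n4 := hnext 4
  have n5 := hnext 5
  have p0 := hprev 0
  have p1 := hprev 1
  have p2 := hprev 2
  have p3 := hprev 3
  have p4 := hprev 4
  have p5 := hprev 5
  have d0 := hd 0
  have d1 := hd 1
  have d2 := hd 2
  have d3 := hd 3
  have d4 := hd 4
  have d5 := hd 5
  have q0 := h1 0
  have q1 := h1 1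
  have q2 := h1 2
  have q3 := h1 3
  have q4 := h1 4
  have q5 := h1 5
  have s0 := h2 0
  have s1 := h2 1
  have s2 := h2 2
  have s3 := h2 3
  have s4 := h2 4
  have s5 := h2 5
  simp only [Fin.isValue, Fin.reduceAdd, diagPattern, Matrix.cons_val]
    at n0 n1 n2 n3 n4 n5 p0 p1 p2 p3 p4 p5 d0 d1 d2 d3 d4 d5
  simp only [n0, p5, d0] at q0 s0
  simp only [n1, p0, d1] at q1 s1
  simp only [n2, p1, d2] at q2 s2
  simp only [n3, p2, d3] at q3 s3
  simp only [n4, p3, d4] at q4 s4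
  simp only [n5, p4, d5] at q5 s5
  refine ⟨?_, ?_, ?_, ?_, ?_, ?_, ?_, ?_, ?_, ?_, ?_, ?_⟩
  · linear_combination (-1) / 4 * q0
  · linear_combination (-2 - y) / 4 * q0 + (1 / 2) * s0
  · linear_combination (-18 + 3 * y + 2 * y ^ 2) / 3 * q1 + (48 - 3 * y - 4 * y ^ 2) / 12 * s1 +
    ((2 / 3) * t + (5 - 4 * y) / 12 * U 1 3 + (-4 + 2 * y) / 3 * U 1 5) * hy
  · linear_combination (-18 + 3 * y + 2 * y ^ 2) / 12 * q1 + (15 - y ^ 2) / 12 * s1 + ((1 / 6) *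
    t + (2 - y) / 12 * U 1 3 + (-7 + 2 * y) / 12 * U 1 5) * hy
  · linear_combination (-1) / 2 * q2 + (1 / 2) * s2 + ((-17) / 356 * t) * hy
  · linear_combination (1 / 2) * q2
  · linear_combination (4 + y) / 16 * s3 + ((-1) / 16 * t + (-1) / 4 * U 3 5) * hy
  · linear_combination (-8 + 2 * y + y ^ 2) / 4 * q3 + (16 - y ^ 2) / 16 * s3 + ((y / 16) * t +
    (-1) / 4 * U 3 1) * hy
  · linear_combination (18 - y ^ 2) / 12 * q4 + (-12 + y ^ 2) / 12 * s4 + ((1 / 12) * U 4 1 + (1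
    / 6) * U 4 2) * hy
  · linear_combination (12 - y ^ 2) / 24 * q4 + (-12 + y ^ 2) / 24 * s4 + ((1 / 24) * U 4 1 + (1
    / 12) * U 4 2) * hy
  · linear_combination (-8 + 2 * y + y ^ 2) / 4 * q5 + (4 + y) / 4 * s5 + ((-68 + 240 * y - 10 *
    y ^ 2 - 17 * y ^ 3) / 1424 * t + (-1) / 4 * U 5 1) * hy
  · linear_combination (-4 - y) / 4 * s5 + ((-240 + 10 * y + 17 * y ^ 2) / 356 * t + (-1) / 4 * U
    5 3) * hy

/-- Each entry at cyclic distance two is computed once from its row and once from its column.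
Equating the two values leaves linear equations in `t` and the six antipodal entries only. -/
theorem eq_zero_of_kernel_of_pattern {K : Type*} [Field K] [CharZero K] {y t : K}
    (hy : y ^ 3 - 12 * y + 12 = 0) {U : Fin 6 → Fin 6 → K}
    (h1 : ∀ a, U a 0 * 2 + U a 1 * (-2 + y) + U a 2 * (-4) + U a 3 * (-2 + y) +
      U a 5 * (8 - 6 * y + y ^ 2) = 0)
    (h2 : ∀ a, U a 0 * 2 + U a 2 * (-4 - 2 * y) + U a 3 * (-4 + 4 * y - y ^ 2) + U a 4 * 2 +
      U a 5 * (16 - 16 * y + 4 * y ^ 2) = 0)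
    (h3 : ∀ a, U 0 a * 2 + U 1 a * (-2 + y) + U 2 a * (-4) + U 3 a * (-2 + y) +
      U 5 a * (8 - 6 * y + y ^ 2) = 0)
    (h4 : ∀ a, U 0 a * 2 + U 2 a * (-4 - 2 * y) + U 3 a * (-4 + 4 * y - y ^ 2) + U 4 a * 2 +
      U 5 a * (16 - 16 * y + 4 * y ^ 2) = 0)
    (hnext : ∀ a, U a (a + 1) = 0) (hprev : ∀ a, U (a + 1) a = 0)
    (hd : ∀ a, U a a = diagPattern y a * t) : U = 0 := by
  obtain ⟨r02, r04, r13, r15, r24, r20, r35, r31, r40, r42, r51, r53⟩ := kernel_row_formulas hy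
    h1 h2 hnext hprev hd
  -- The hypotheses are symmetric under transposition, so the same formulas hold for columns.
  obtain ⟨c02, c04, c13, c15, c24, c20, c35, c31, c40, c42, c51, c53⟩ := kernel_row_formulas (U
    := fun a b => U b a) hy h3 h4 hprev hnext hd
  -- Four comparisons, at the entries (0,4), (1,3), (1,5), (2,4), involve only `t`, `U 0 3`, `U 1 4`
  -- and `U 2 5`.
  have ht : t = 0 := by
    linear_combination (-2 + 2 * y + y ^ 2) / 12 * r04 + (2 - 2 * y - y ^ 2) / 12 * c40 + (22 -
      28 * y + 7 * y ^ 2) / 6 * r13 + (-22 + 28 * y - 7 * y ^ 2) / 6 * c31 + (-164 + 202 * y - 51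
      * y ^ 2) / 12 * r15 + (164 - 202 * y + 51 * y ^ 2) / 12 * c51 + (52 - 14 * y - 9 * y ^ 2) /
      12 * r24 + (-52 + 14 * y + 9 * y ^ 2) / 12 * c42 + ((370 - 97 * y) / 534 * t + (-5 + 4 * y)
      / 8 * U 0 3 + (12 + y) / 48 * U 1 4 + (-12 + 15 * y) / 2 * U 2 5) * hy
  simp only [ht, mul_zero, zero_add] at hd r02 r04 r13 r15 r24 r20 r35 r31 r40 r42 r51 r53
  simp only [ht, mul_zero, zero_add] at c02 c04 c13 c15 c24 c20 c35 c31 c40 c42 c51 c53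
  -- With `t = 0` the antipodal entries split into three pairs, each with a nonsingular 2 × 2
  -- system.
  have x0 : U 0 3 = 0 := by
    linear_combination (1616 - 186 * y - 156 * y ^ 2) / 267 * r04 + (-1616 + 186 * y + 156 * y ^
      2) / 267 * c40 + (-296 + 42 * y + 18 * y ^ 2) / 267 * r13 + (296 - 42 * y - 18 * y ^ 2) /
      267 * c31 + ((275 - 147 * y) / 356 * U 0 3 + (-72 - 14 * y) / 267 * U 1 4) * hy
  have x1 : U 1 4 = 0 := by
    linear_combination (-24 - 88 * y - 25 * y ^ 2) / 534 * r04 + (24 + 88 * y + 25 * y ^ 2) / 534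
      * c40 + (-204 + 320 * y - 79 * y ^ 2) / 267 * r13 + (204 - 320 * y + 79 * y ^ 2) / 267 *
      c31 + ((11 - 13 * y) / 89 * U 0 3 + (641 - 219 * y) / 1068 * U 1 4) * hy
  have x2 : U 2 5 = 0 := by
    linear_combination (-18 + 3 * y + 2 * y ^ 2) / 18 * r20 + (18 - 3 * y - 2 * y ^ 2) / 18 * c02
      + (-3 * y + y ^ 2) / 9 * r35 + (3 * y - y ^ 2) / 9 * c53 + ((5 / 12) * U 2 5 + (-1) / 24 *
      U 3 0) * hy
  have x3 : U 3 0 = 0 := by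
    linear_combination (-120 + 24 * y + 14 * y ^ 2) / 9 * r20 + (120 - 24 * y - 14 * y ^ 2) / 9 *
      c02 + (24 - 48 * y + 14 * y ^ 2) / 9 * r35 + (-24 + 48 * y - 14 * y ^ 2) / 9 * c53 + ((16 /
      3) * U 2 5 + (-7) / 12 * U 3 0) * hy
  have x4 : U 4 1 = 0 := by
    linear_combination (-24 + 5 * y + 3 * y ^ 2) / 3 * r42 + (24 - 5 * y - 3 * y ^ 2) / 3 * c24 +
      (12 - 13 * y + 3 * y ^ 2) / 3 * r51 + (-12 + 13 * y - 3 * y ^ 2) / 3 * c15 + ((7 - 3 * y) /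
      12 * U 4 1 + (-4 + 3 * y) * U 5 2) * hy
  have x5 : U 5 2 = 0 := by
    linear_combination (52 - 6 * y - 5 * y ^ 2) / 12 * r42 + (-52 + 6 * y + 5 * y ^ 2) / 12 * c24
      + (-8 + y ^ 2) / 12 * r51 + (8 - y ^ 2) / 12 * c15 + ((2 + y) / 48 * U 4 1 + (7 - 2 * y) /
      4 * U 5 2) * hy
  simp only [x0, x1, x2, x3, x4, x5, mul_zero] at r02 r04 r13 r15 r24 r20 r35 r31 r40 r42 r51 r53
  ext a b
  have hn := hnext a
  have hp := hprev b
  fin_cases a <;> fin_cases b <;>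
    first
    | exact hd _
    | exact hn
    | exact hp
    | assumption

/-! ### The explicit Kraus operators and the factorization of `X`. -/

section Model

/-- The real profiles of the four Kraus operators on the product vectors, in cyclic order. -/
def profile (y : ℝ) : Fin 4 → Fin 6 → ℝ :=
  ![![1, 0, 1 / 2, 0, y / 2, 0],
    ![0, 0, 1, 0, (-26 + 23 * y + 4 * y ^ 2) / 7, (26 - 9 * y - 4 * y ^ 2) / 7],
    ![0, -2 + y ^ 2 / 8, 0, 0, 1, -1 / 2 - y / 8],
    ![0, -y / 4, 0, 1, 0, 1 / 4]]

/-- The weights of the profiles in the Gram matrix. -/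
def pivot (y : ℝ) : Fin 4 → ℝ :=
  ![2, (151 - 10 * y - 17 * y ^ 2) / 178, (16 - 12 * y + 4 * y ^ 2) / 7, 4]

/-- The Gram matrix `∑ k, pivot k • profile k ⊗ profile k`. -/
def gram (y : ℝ) : Matrix (Fin 6) (Fin 6) ℝ :=
  !![2, 0, 1, 0, y, 0;
     0, 4, 0, -y, -2, 1;
     1, 0, (240 - 10 * y - 17 * y ^ 2) / 178, 0, 1, (230 - 17 * y - 20 * y ^ 2) / 178;
     0, -y, 0, 4, 0, 1;
     y, -2, 1, 0, 2, 0;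
     0, 1, (230 - 17 * y - 20 * y ^ 2) / 178, 1, 0, (240 - 10 * y - 17 * y ^ 2) / 89]

theorem sum_pivot_mul_profile {y : ℝ} (hy : y ^ 3 - 12 * y + 12 = 0) (a b : Fin 6) :
    ∑ k, pivot y k * (profile y k a * profile y k b) = gram y a b := by
  fin_cases a <;> fin_cases b <;>
    simp [Fin.sum_univ_four, pivot, profile, gram] <;> grind

/-- The phases and weights of the product vectors, in cyclic order. -/
def phase (m : ℝ) : Fin 6 → ℂ := ![1, -Complex.I, Complex.I * m, -Complex.I, 1, m]

/-- The coefficients of the Kraus operators on the product vectors, in cyclic order. -/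
def krausCoeff (y m : ℝ) : Matrix (Fin 6) (Fin 4) ℂ :=
  Matrix.of fun a k => phase m a * ((Real.sqrt (pivot y k / 6) * profile y k a : ℝ) : ℂ)

/-- The four Kraus operators. -/
def kraus (y m : ℝ) (k : Fin 4) : Mat 3 :=
  !![0, krausCoeff y m 3 k, krausCoeff y m 4 k;
     krausCoeff y m 0 k, 0, krausCoeff y m 5 k;
     krausCoeff y m 1 k, krausCoeff y m 2 k, 0]

/-- The nonzero block of six times the Choi matrix of the channel, in cyclic order. -/
def choiBlock (y m : ℝ) : Matrix (Fin 6) (Fin 6) ℂ :=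
  !![2, 0, -Complex.I * m, 0, y, 0;
     0, 4, 0, -y, 2 * Complex.I, -Complex.I * m;
     Complex.I * m, 0, 2, 0, Complex.I * m, Complex.I * (2 - y ^ 2 / 6);
     0, -y, 0, 4, 0, -Complex.I * m;
     y, -2 * Complex.I, -Complex.I * m, 0, 2, 0;
     0, Complex.I * m, -Complex.I * (2 - y ^ 2 / 6), Complex.I * m, 0, 4]

/-- Positive weights allow the real factors `√(pivot / 6)` in the Kraus operators. -/
theorem pivot_pos {y : ℝ} (h1 : 1.11574 < y) (h2 : y < 1.11576) (k : Fin 4) : 0 < pivot y k := by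
  fin_cases k <;> simp [pivot] <;> nlinarith

theorem phase_mul_star_phase_mul_gram {y m : ℝ} (hy : y ^ 3 - 12 * y + 12 = 0)
    (hm : m ^ 2 = 2 - y + 2 / 3 * y ^ 2) (a b : Fin 6) :
    phase m a * star (phase m b) * gram y a b = choiBlock y m a b := by
  have hyC : (y : ℂ) ^ 3 - 12 * y + 12 = 0 := by exact_mod_cast congrArg ((↑) : ℝ → ℂ) hy
  have hmC : (m : ℂ) ^ 2 = 2 - y + 2 / 3 * y ^ 2 := by
    simpa using congrArg ((↑) : ℝ → ℂ) hm
  have hI := Complex.I_sq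
  fin_cases a <;> fin_cases b <;> simp [phase, gram, choiBlock] <;> grind

theorem krausCoeff_mul_conjTranspose {y m : ℝ} (hy : y ^ 3 - 12 * y + 12 = 0)
    (hm : m ^ 2 = 2 - y + 2 / 3 * y ^ 2) (h1 : 1.11574 < y) (h2 : y < 1.11576) (a b : Fin 6) :
    ∑ k, krausCoeff y m a k * star (krausCoeff y m b k) = choiBlock y m a b / 6 := by
  rw [← phase_mul_star_phase_mul_gram hy hm, ← sum_pivot_mul_profile hy, Complex.ofReal_sum,
    Finset.mul_sum, Finset.sum_div]
  refine Finset.sum_congr rfl fun k _ => ?_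
  have hs : ((Real.sqrt (pivot y k / 6) : ℝ) : ℂ) ^ 2 = pivot y k / 6 := by
    rw [← Complex.ofReal_pow, Real.sq_sqrt (by linarith [pivot_pos h1 h2 k])]
    simp
  simp only [krausCoeff, Matrix.of_apply, star_mul', Complex.star_def, Complex.conj_ofReal,
    Complex.ofReal_mul]
  linear_combination phase m a * (starRingEnd ℂ) (phase m b) * (profile y k a : ℂ) *
    profile y k b * hs

theorem sum_conjTranspose_kraus_mul {y m : ℝ} (hy : y ^ 3 - 12 * y + 12 = 0)
    (hm : m ^ 2 = 2 - y + 2 / 3 * y ^ 2) (h1 : 1.11574 < y) (h2 : y < 1.11576) :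
    ∑ k, (kraus y m k)ᴴ * kraus y m k = 1 := by
  have h := krausCoeff_mul_conjTranspose hy hm h1 h2
  simp only [Complex.star_def] at h
  ext i j
  rw [Matrix.sum_apply]
  simp only [Matrix.mul_apply, conjTranspose_apply, Fin.sum_univ_three, mul_comm (star _)]
  fin_cases i <;> fin_cases j <;>
    simp [kraus, Finset.sum_add_distrib, h, choiBlock]
  all_goals norm_num

theorem sum_kraus_mul_conjTranspose {y m : ℝ} (hy : y ^ 3 - 12 * y + 12 = 0)
    (hm : m ^ 2 = 2 - y + 2 / 3 * y ^ 2) (h1 : 1.11574 < y) (h2 : y < 1.11576) :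
    ∑ k, kraus y m k * (kraus y m k)ᴴ = 1 := by
  have h := krausCoeff_mul_conjTranspose hy hm h1 h2
  simp only [Complex.star_def] at h
  ext i j
  rw [Matrix.sum_apply]
  simp only [Matrix.mul_apply, conjTranspose_apply, Fin.sum_univ_three]
  fin_cases i <;> fin_cases j <;>
    simp [kraus, Finset.sum_add_distrib, h, choiBlock]
  all_goals norm_num

/-- At positions 0, 2, 4, 3 the four profiles form a unit upper triangular matrix, so the
coefficients vanish one after another. -/
theorem linearIndependent_kraus {y m : ℝ} (hm0 : m ≠ 0) (h1 : 1.11574 < y) (h2 : y < 1.11576) :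
    LinearIndependent ℂ (kraus y m) := by
  have hm0' : (m : ℂ) ≠ 0 := by exact_mod_cast hm0
  rw [Fintype.linearIndependent_iff]
  intro g hg
  have hentry : ∀ i j, ∑ k, g k * kraus y m k i j = 0 := by
    intro i j
    have := congrFun (congrFun hg i) j
    simpa [Matrix.sum_apply] using this
  have hs : ∀ k, ((Real.sqrt (pivot y k / 6) : ℝ) : ℂ) ≠ 0 := by
    intro k
    have := Real.sqrt_pos.mpr (show 0 < pivot y k / 6 by linarith [pivot_pos h1 h2 k])
    exact_mod_cast this.ne'
  have hc : ∀ a k, krausCoeff y m a k =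
      phase m a * (((Real.sqrt (pivot y k / 6) : ℝ) : ℂ) * (profile y k a : ℝ)) := by
    intro a k
    rw [krausCoeff, Matrix.of_apply, Complex.ofReal_mul]
  have hs₀ := hs 0
  have hs₁ := hs 1
  have hs₂ := hs 2
  have hs₃ := hs 3
  have e0 := hentry 1 0
  have e2 := hentry 2 1
  have e3 := hentry 0 1
  have e4 := hentry 0 2
  simp only [Fin.sum_univ_four, kraus, hc] at e0 e2 e3 e4
  generalize ((Real.sqrt (pivot y 0 / 6) : ℝ) : ℂ) = w₀ at hs₀ e0 e2 e3 e4
  generalize ((Real.sqrt (pivot y 1 / 6) : ℝ) : ℂ) = w₁ at hs₁ e0 e2 e3 e4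
  generalize ((Real.sqrt (pivot y 2 / 6) : ℝ) : ℂ) = w₂ at hs₂ e0 e2 e3 e4
  generalize ((Real.sqrt (pivot y 3 / 6) : ℝ) : ℂ) = w₃ at hs₃ e0 e2 e3 e4
  simp [phase, profile, hs₀, hs₃] at e0 e2 e3 e4
  simp [e0, hs₁, hm0'] at e2
  simp [e0, e2, hs₂] at e4
  intro k
  fin_cases k
  · exact e0
  · exact e2
  · exact e4
  · exact e3

/-- `√2` times the change of basis from the product vectors to `psi`. -/
def psiCoeff : Matrix (Fin 6) (Fin 6) ℂ :=
  !![1, 0, 0, 1, 0, 0;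
     0, 1, 0, 0, 1, 0;
     0, 0, 1, 0, 0, 1;
     Complex.I, 0, 0, -Complex.I, 0, 0;
     0, Complex.I, 0, 0, -Complex.I, 0;
     0, 0, Complex.I, 0, 0, -Complex.I]

/-- A square root of `matX`: its columns are the Kraus operators in the basis `psi`. -/
def sqrtX (y m : ℝ) : Matrix (Fin 6) (Fin 4) ℂ :=
  (1 / ((Real.sqrt 2 : ℝ) * (Real.sqrt 3 : ℝ)) : ℂ) • (psiCoeff * krausCoeff y m)

theorem ofReal_sqrt_sq (n : ℕ) : ((Real.sqrt n : ℝ) : ℂ) ^ 2 = n := by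
  rw [← Complex.ofReal_pow, Real.sq_sqrt (Nat.cast_nonneg n), Complex.ofReal_natCast]

set_option maxHeartbeats 2000000 in
theorem sqrtX_mul_conjTranspose {y m : ℝ} (hy : y ^ 3 - 12 * y + 12 = 0)
    (hm : m ^ 2 = 2 - y + 2 / 3 * y ^ 2) (h1 : 1.11574 < y) (h2 : y < 1.11576) :
    sqrtX y m * (sqrtX y m)ᴴ = matX (1 / 6 * m) (-(1 - y ^ 2 / 12) / 6) (1 / 6) (y / 6) := by
  have hG : krausCoeff y m * (krausCoeff y m)ᴴ = (1 / 6 : ℂ) • choiBlock y m := by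
    ext a b
    rw [Matrix.mul_apply, Matrix.smul_apply, smul_eq_mul, one_div_mul_eq_div,
      ← krausCoeff_mul_conjTranspose hy hm h1 h2]
    rfl
  -- The factor `1/√2` normalises `psi` and `1/√3` normalises `|Ω⟩`.
  have hc : (1 / ((Real.sqrt 2 : ℝ) * (Real.sqrt 3 : ℝ)) : ℂ) *
      star (1 / ((Real.sqrt 2 : ℝ) * (Real.sqrt 3 : ℝ)) : ℂ) = 1 / 6 := by
    have e2 := ofReal_sqrt_sq 2
    have e3 := ofReal_sqrt_sq 3
    push_cast at e2 e3
    simp only [star_div₀, star_one, star_mul', Complex.star_def, Complex.conj_ofReal]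
    rw [div_mul_div_comm, ← sq (_ * _), mul_pow, e2, e3]
    norm_num
  have : sqrtX y m * (sqrtX y m)ᴴ =
      (1 / 36 : ℂ) • (psiCoeff * choiBlock y m * psiCoeffᴴ) := by
    rw [sqrtX, conjTranspose_smul, Matrix.smul_mul, Matrix.mul_smul, smul_smul, hc,
      conjTranspose_mul, Matrix.mul_assoc, ← Matrix.mul_assoc (krausCoeff y m), hG,
      Matrix.smul_mul, Matrix.mul_smul, smul_smul, ← Matrix.mul_assoc]
    norm_num
  rw [this]
  have hI := Complex.I_sq
  ext i j
  simp only [Matrix.smul_apply, Matrix.mul_apply, Fin.sum_univ_six, conjTranspose_apply]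
  fin_cases i <;> fin_cases j <;> simp [psiCoeff, choiBlock, matX] <;> grind only

theorem sum_psi_mul_sqrtX (y m : ℝ) (k : Fin 4) (p : Fin 3 × Fin 3) :
    ∑ i, psi i p * sqrtX y m i k = 1 / (Real.sqrt 3 : ℝ) * kraus y m k p.2 p.1 := by
  have e2 := ofReal_sqrt_sq 2
  have h2 : ((Real.sqrt 2 : ℝ) : ℂ) ≠ 0 := by simp
  have h3 : ((Real.sqrt 3 : ℝ) : ℂ) ≠ 0 := by simp
  have hI := Complex.I_sq
  push_cast at e2
  obtain ⟨a, b⟩ := p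
  simp only [sqrtX, Matrix.smul_apply, Matrix.mul_apply, Fin.sum_univ_six]
  fin_cases a <;> fin_cases b <;> simp [psi, ket, psiCoeff, kraus]
    <;> field_simp <;> grind only

end Model

/-! ### Vanishing marginals and kernel conditions force zero. -/

section Rigidity

/-- The product basis vectors `|jk⟩` with `j ≠ k`, ordered so that cyclic neighbours share an
index in the same slot. -/
def offDiagIndex : Fin 6 → Fin 3 × Fin 3 := ![(0, 1), (0, 2), (1, 2), (1, 0), (2, 0), (2, 1)]

theorem eq_or_exists_offDiagIndex : ∀ p : Fin 3 × Fin 3, (∃ i, p = (i, i)) ∨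
    ∃ a, p = offDiagIndex a := by
  decide

/-- Real vectors spanning the orthogonal complement of the profiles. -/
def kernelProfile (y : ℝ) : Fin 2 → Fin 6 → ℝ :=
  ![![2, -2 + y, -4, -2 + y, 0, 8 - 6 * y + y ^ 2],
    ![2, 0, -4 - 2 * y, -4 + 4 * y - y ^ 2, 2, 16 - 16 * y + 4 * y ^ 2]]

/-- The vectors on `ℂ³ ⊗ ℂ³` corresponding to `kernelProfile`. -/
def kernelVec (y m : ℝ) (j : Fin 2) (p : Fin 3 × Fin 3) : ℂ :=
  !![0, (m * kernelProfile y j 0 : ℂ), -Complex.I * m * kernelProfile y j 1;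
     -Complex.I * m * kernelProfile y j 3, 0, Complex.I * kernelProfile y j 2;
     m * kernelProfile y j 4, (kernelProfile y j 5 : ℂ), 0] p.1 p.2

/-- Inverse conjugates of the phases and weights of the product vectors. -/
def dualPhase (m : ℝ) : Fin 6 → ℂ :=
  ![1, -Complex.I, Complex.I / m, -Complex.I, 1, 1 / m]

theorem dualPhase_ne_zero {m : ℝ} (hm : m ≠ 0) (a : Fin 6) : dualPhase m a ≠ 0 := by
  fin_cases a <;> simp [dualPhase, hm]

theorem sum_mul_dualPhase {y m : ℝ} (hm : m ≠ 0) (j : Fin 2) {f : Fin 3 × Fin 3 → ℂ}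
    (hf0 : ∀ i, f (i, i) = 0) (hf : ∑ p, f p * kernelVec y m j p = 0) :
    ∑ b, f (offDiagIndex b) * dualPhase m b * kernelProfile y j b = 0 := by
  have hm' : (m : ℂ) ≠ 0 := by exact_mod_cast hm
  -- On the off-diagonal product vectors `kernelVec` is `m * dualPhase * kernelProfile`; the factor
  -- `m` clears the denominators.
  have h : (m : ℂ) * ∑ b, f (offDiagIndex b) * dualPhase m b * kernelProfile y j b = 0 := by
    rw [← hf]
    simp only [Fintype.sum_prod_type, Fin.sum_univ_three, Fin.sum_univ_six, hf0, kernelVec,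
      offDiagIndex, dualPhase, Fin.isValue, Matrix.of_apply, Matrix.cons_val]
    field_simp
    ring
  exact (mul_eq_zero.mp h).resolve_left hm'

/-- A matrix with vanishing marginals whose rows and columns are orthogonal to the kernel
vanishes. -/
theorem eq_zero_of_marginals_of_kernel {y m : ℝ} (hy : y ^ 3 - 12 * y + 12 = 0)
    (hm : m ^ 2 = 2 - y + 2 / 3 * y ^ 2) (hm0 : m ≠ 0)
    {W : Matrix (Fin 3 × Fin 3) (Fin 3 × Fin 3) ℂ}
    (hz1 : ∀ i q, W (i, i) q = 0) (hz2 : ∀ p i, W p (i, i) = 0)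
    (hr : ∀ j p, ∑ q, W p q * kernelVec y m j q = 0)
    (hl : ∀ j q, ∑ p, W p q * star (kernelVec y m j p) = 0)
    (hm1 : ∀ i j, ∑ a, W (i, a) (j, a) = 0) (hm2 : ∀ a b, ∑ i, W (i, a) (i, b) = 0) :
    W = 0 := by
  set U : Fin 6 → Fin 6 → ℂ := fun a b =>
    star (dualPhase m a) * W (offDiagIndex a) (offDiagIndex b) * dualPhase m b with hU
  have hrow : ∀ j a, ∑ b, U a b * kernelProfile y j b = 0 := by
    intro j a
    have := sum_mul_dualPhase hm0 j (f := W (offDiagIndex a)) (hz2 _) (hr j _)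
    rw [← mul_zero (star (dualPhase m a)), ← this, Finset.mul_sum]
    exact Finset.sum_congr rfl fun b _ => by rw [hU]; ring
  have hcol : ∀ j b, ∑ a, U a b * kernelProfile y j a = 0 := by
    intro j b
    have := sum_mul_dualPhase (y := y) hm0 j (f := fun p => star (W p (offDiagIndex b)))
      (fun i => by simp [hz1]) (by
        rw [← star_zero, ← hl j (offDiagIndex b), star_sum]
        exact Finset.sum_congr rfl fun p _ => by simp)
    have := congrArg star this
    rw [star_zero, star_sum] at this
    rw [← mul_zero (dualPhase m b), ← this, Finset.mul_sum]
    refine Finset.sum_congr rfl fun a _ => ?_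
    simp [hU]
    ring
  simp only [Fin.sum_univ_three] at hm1 hm2
  have hyC : (y : ℂ) ^ 3 - 12 * y + 12 = 0 := by exact_mod_cast congrArg ((↑) : ℝ → ℂ) hy
  have hmC : (m : ℂ) ^ 2 = 2 - y + 2 / 3 * y ^ 2 := by
    simpa using congrArg ((↑) : ℝ → ℂ) hm
  have hmC0 : (m : ℂ) ≠ 0 := by exact_mod_cast hm0
  have hdiag : ∀ a, W (offDiagIndex a) (offDiagIndex a) =
      (![1, -1, 1, -1, 1, -1] : Fin 6 → ℂ) a * W (0, 1) (0, 1) := by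
    -- Each diagonal marginal has two surviving terms, which belong to cyclic neighbours. Five of
    -- the six relations suffice, since both families sum to the trace.
    have a0 := hm1 0 0
    have a1 := hm1 1 1
    have a2 := hm1 2 2
    have b1 := hm2 1 1
    have b2 := hm2 2 2
    simp only [hz1] at a0 a1 a2 b1 b2
    intro a
    fin_cases a <;> simp [offDiagIndex] <;> grind
  -- In an off-diagonal marginal two of the three terms involve some `|ii⟩`; the survivor couples
  -- cyclic neighbours.
  have hadj : ∀ a, W (offDiagIndex a) (offDiagIndex (a + 1)) = 0 := by
    have a1 := hm1 0 1
    have a2 := hm1 1 2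
    have a3 := hm1 2 0
    have b1 := hm2 0 1
    have b2 := hm2 1 2
    have b3 := hm2 2 0
    simp only [hz1, hz2, add_zero, zero_add] at a1 a2 a3 b1 b2 b3
    intro a
    fin_cases a <;> assumption
  have hadj' : ∀ a, W (offDiagIndex (a + 1)) (offDiagIndex a) = 0 := by
    have a1 := hm1 1 0
    have a2 := hm1 2 1
    have a3 := hm1 0 2
    have b1 := hm2 1 0
    have b2 := hm2 2 1
    have b3 := hm2 0 2
    simp only [hz1, hz2, add_zero, zero_add] at a1 a2 a3 b1 b2 b3
    intro a
    fin_cases a <;> assumption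
  -- This inverse of `m²` in `ℚ(y)` yields the entries 2 and 5 of `diagPattern`.
  have hinv : (120 - 5 * (y : ℂ) - 17 / 2 * y ^ 2) / 178 * m ^ 2 = 1 := by
    rw [hmC]; grind
  have hU0 : U = 0 := by
    refine eq_zero_of_kernel_of_pattern (t := W (0, 1) (0, 1)) hyC ?_ ?_ ?_ ?_
      (fun a => by simp [hU, hadj]) (fun a => by simp [hU, hadj']) ?_
    · intro a
      simpa [Fin.sum_univ_six, kernelProfile] using hrow 0 a
    · intro a
      simpa [Fin.sum_univ_six, kernelProfile] using hrow 1 a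
    · intro a
      simpa [Fin.sum_univ_six, kernelProfile] using hcol 0 a
    · intro a
      simpa [Fin.sum_univ_six, kernelProfile] using hcol 1 a
    · intro a
      simp only [hU]
      rw [mul_right_comm, hdiag]
      have hphase : star (dualPhase m a) * dualPhase m a *
          (![1, -1, 1, -1, 1, -1] : Fin 6 → ℂ) a = diagPattern (y : ℂ) a := by
        fin_cases a <;> simp [dualPhase, diagPattern]
        all_goals
          field_simp
          try simp only [Complex.I_sq]
          grind
      rw [← hphase]; ring
  ext p q
  rcases eq_or_exists_offDiagIndex p with ⟨i, rfl⟩ | ⟨a, rfl⟩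
  · exact hz1 _ _
  rcases eq_or_exists_offDiagIndex q with ⟨i, rfl⟩ | ⟨b, rfl⟩
  · exact hz2 _ _
  have := congrFun (congrFun hU0 a) b
  simpa [hU, dualPhase_ne_zero hm0] using this

end Rigidity

/-! ### The channel: Jamiołkowski state, independence of products, extremality. -/

section Channel

theorem sum_profile_mul_kernelProfile {y : ℝ} (hy : y ^ 3 - 12 * y + 12 = 0) (k : Fin 4)
    (j : Fin 2) : ∑ a, profile y k a * kernelProfile y j a = 0 := by
  fin_cases k <;> fin_cases j <;> simp [Fin.sum_univ_six, profile, kernelProfile] <;> grind only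

theorem sum_star_kraus_mul_kernelVec {y : ℝ} (hy : y ^ 3 - 12 * y + 12 = 0) (m : ℝ) (k : Fin 4)
    (j : Fin 2) : ∑ p : Fin 3 × Fin 3, star (kraus y m k p.2 p.1) * kernelVec y m j p = 0 := by
  have h : ((∑ a, profile y k a * kernelProfile y j a : ℝ) : ℂ) = 0 := by
    rw [sum_profile_mul_kernelProfile hy, Complex.ofReal_zero]
  rw [← mul_zero ((m : ℂ) * ((Real.sqrt (pivot y k / 6) : ℝ) : ℂ)), ← h]
  have hc : ∀ a, krausCoeff y m a k =
      phase m a * (((Real.sqrt (pivot y k / 6) : ℝ) : ℂ) * (profile y k a : ℝ)) := by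
    intro a
    rw [krausCoeff, Matrix.of_apply, Complex.ofReal_mul]
  simp only [Fintype.sum_prod_type, Fin.sum_univ_three, Fin.sum_univ_six, Complex.ofReal_add,
    Complex.ofReal_mul, kraus, kernelVec, hc]
  simp [phase]
  ring_nf
  rw [Complex.I_sq]
  ring

variable {y m : ℝ}

theorem choi_krausForm_one (p q : Fin 3 × Fin 3) :
    choi (krausForm (kraus y m) 1) p q =
      ∑ k, kraus y m k p.2 p.1 * star (kraus y m k q.2 q.1) := by
  simp [choi_krausForm, Matrix.one_apply]

theorem jamiolkowski_krausForm {X : Matrix (Fin 6) (Fin 6) ℂ}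
    (hX : sqrtX y m * (sqrtX y m)ᴴ = X) :
    jamiolkowski (krausForm (kraus y m) 1) = ∑ i, ∑ j, X i j • ketBra (psi i) (psi j) := by
  have e3 := ofReal_sqrt_sq 3
  have h3 : ((Real.sqrt 3 : ℝ) : ℂ) ≠ 0 := by simp
  push_cast at e3
  ext p q
  have h := fun (k : Fin 4) (p : Fin 3 × Fin 3) => sum_psi_mul_sqrtX y m k p
  have hl : jamiolkowski (krausForm (kraus y m) 1) p q =
      ∑ k, (∑ i, psi i p * sqrtX y m i k) * star (∑ j, psi j q * sqrtX y m j k) := by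
    rw [jamiolkowski_eq_choi, Matrix.smul_apply, choi_krausForm_one, smul_eq_mul, Finset.mul_sum]
    refine Finset.sum_congr rfl fun k _ => ?_
    rw [h, h, star_mul', Complex.star_def, map_div₀, Complex.conj_ofReal, map_one]
    push_cast
    rw [← e3]
    field_simp
  rw [hl, ← hX]
  simp only [Matrix.sum_apply, Matrix.smul_apply, ketBra, vecMulVec_apply, Pi.star_apply,
    smul_eq_mul, Matrix.mul_apply, conjTranspose_apply, star_sum, star_mul', Finset.sum_mul,
    Finset.mul_sum]
  rw [Finset.sum_comm]
  conv_rhs => rw [Finset.sum_comm]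
  refine Finset.sum_congr rfl fun i _ => ?_
  rw [Finset.sum_comm]
  exact Finset.sum_congr rfl fun j _ => Finset.sum_congr rfl fun k _ => by ring

/-- The columns of `sqrtX` are coordinates of rescaled Kraus operators and inherit their
independence. -/
theorem rank_sqrtX_mul_conjTranspose (hm0 : m ≠ 0) (h1 : 1.11574 < y) (h2 : y < 1.11576) :
    (sqrtX y m * (sqrtX y m)ᴴ).rank = 4 := by
  rw [rank_self_mul_conjTranspose, ← rank_transpose]
  have hli : LinearIndependent ℂ (sqrtX y m)ᵀ.row := by
    rw [Fintype.linearIndependent_iff]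
    intro g hg
    refine Fintype.linearIndependent_iff.mp (linearIndependent_kraus hm0 h1 h2) g ?_
    have hg' : ∀ i, ∑ k, g k * sqrtX y m i k = 0 := by
      intro i
      have := congrFun hg i
      simpa [Finset.sum_apply] using this
    ext b a
    have h3 : (1 / (Real.sqrt 3 : ℝ) : ℂ) ≠ 0 := by simp
    refine (mul_eq_zero.mp ?_).resolve_left h3
    rw [Matrix.sum_apply, Finset.mul_sum]
    calc ∑ k, 1 / (Real.sqrt 3 : ℝ) * (g k • kraus y m k) b a
        = ∑ k, ∑ i, psi i (a, b) * (g k * sqrtX y m i k) := by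
          refine Finset.sum_congr rfl fun k _ => ?_
          rw [Matrix.smul_apply, smul_eq_mul, mul_left_comm, ← sum_psi_mul_sqrtX y m k (a, b),
            Finset.mul_sum]
          exact Finset.sum_congr rfl fun i _ => by ring
      _ = ∑ i, psi i (a, b) * ∑ k, g k * sqrtX y m i k := by
          rw [Finset.sum_comm]
          simp only [Finset.mul_sum]
      _ = 0 := by simp [hg']
  simpa using hli.rank_matrix

theorem linearIndependent_kraus_products (hy : y ^ 3 - 12 * y + 12 = 0)
    (hm : m ^ 2 = 2 - y + 2 / 3 * y ^ 2) (hm0 : m ≠ 0) (h1 : 1.11574 < y) (h2 : y < 1.11576) :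
    LinearIndependent ℂ (fun kl : Fin 4 × Fin 4 =>
      Matrix.fromBlocks ((kraus y m kl.1)ᴴ * kraus y m kl.2) 0 0
        (kraus y m kl.2 * (kraus y m kl.1)ᴴ)) := by
  rw [Fintype.linearIndependent_iff]
  intro g hg
  let A := kraus y m
  -- The partial traces of `W` are, up to transposition, the two diagonal blocks of the vanishing
  -- combination, so rigidity applies; no Hermiticity of `g` is needed.
  let W : Matrix (Fin 3 × Fin 3) (Fin 3 × Fin 3) ℂ := Matrix.of fun p q =>
    ∑ l, ∑ k, g (k, l) * (A l p.2 p.1 * star (A k q.2 q.1))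
  have hW : ∀ p q, W p q = ∑ l, ∑ k, g (k, l) * (A l p.2 p.1 * star (A k q.2 q.1)) :=
    fun _ _ => rfl
  have hA0 : ∀ k i, A k i i = 0 := by
    intro k i
    fin_cases i <;> simp [A, kraus]
  have hker := fun j k => sum_star_kraus_mul_kernelVec hy m k j
  have hb1 : ∀ i j, ∑ k, ∑ l, g (k, l) * ((A k)ᴴ * A l) i j = 0 := by
    intro i j
    have := congrFun (congrFun hg (Sum.inl i)) (Sum.inl j)
    simpa [Matrix.sum_apply, Fintype.sum_prod_type] using this
  have hb2 : ∀ i j, ∑ k, ∑ l, g (k, l) * (A l * (A k)ᴴ) i j = 0 := by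
    intro i j
    have := congrFun (congrFun hg (Sum.inr i)) (Sum.inr j)
    simpa [Matrix.sum_apply, Fintype.sum_prod_type] using this
  have hW0 : W = 0 := by
    refine eq_zero_of_marginals_of_kernel hy hm hm0 ?_ ?_ ?_ ?_ ?_ ?_
    · intro i q
      simp [hW, hA0]
    · intro p i
      simp [hW, hA0]
    · intro j p
      simp only [hW, Finset.sum_mul]
      rw [Finset.sum_comm]
      refine Finset.sum_eq_zero fun l _ => ?_
      rw [Finset.sum_comm]
      refine Finset.sum_eq_zero fun k _ => ?_
      rw [← mul_zero (g (k, l) * A l p.2 p.1), ← hker j k, Finset.mul_sum]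
      exact Finset.sum_congr rfl fun q _ => by ring
    · intro j q
      simp only [hW, Finset.sum_mul]
      rw [Finset.sum_comm]
      refine Finset.sum_eq_zero fun l _ => ?_
      rw [Finset.sum_comm]
      refine Finset.sum_eq_zero fun k _ => ?_
      rw [← mul_zero (g (k, l) * star (A k q.2 q.1)), ← star_zero, ← hker j l, star_sum,
        Finset.mul_sum]
      refine Finset.sum_congr rfl fun q _ => ?_
      rw [star_mul', star_star]
      ring
    · intro i j
      rw [← hb1 j i]
      simp only [hW, Matrix.mul_apply, conjTranspose_apply, Finset.mul_sum]
      rw [Finset.sum_comm]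
      conv_rhs => rw [Finset.sum_comm]
      refine Finset.sum_congr rfl fun l _ => ?_
      rw [Finset.sum_comm]
      exact Finset.sum_congr rfl fun k _ => Finset.sum_congr rfl fun a _ => by ring
    · intro a b
      rw [← hb2 a b]
      simp only [hW, Matrix.mul_apply, conjTranspose_apply, Finset.mul_sum]
      rw [Finset.sum_comm]
      conv_rhs => rw [Finset.sum_comm]
      refine Finset.sum_congr rfl fun l _ => ?_
      rw [Finset.sum_comm]
  have hz := eq_zero_of_sum_mul_star_eq_zero (linearIndependent_kraus hm0 h1 h2)
    (g := Matrix.of fun l k => g (k, l)) fun p q => congrFun (congrFun hW0 p) q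
  rintro ⟨k, l⟩
  exact congrFun (congrFun hz l) k

theorem choi_mulVec_kernelVec (hy : y ^ 3 - 12 * y + 12 = 0) (j : Fin 2) :
    choi (krausForm (kraus y m) 1) *ᵥ kernelVec y m j = 0 := by
  ext p
  simp only [mulVec, dotProduct, choi_krausForm_one, Finset.sum_mul, Pi.zero_apply]
  rw [Finset.sum_comm]
  refine Finset.sum_eq_zero fun k _ => ?_
  rw [← mul_zero (kraus y m k p.2 p.1), ← sum_star_kraus_mul_kernelVec hy m k j, Finset.mul_sum]
  exact Finset.sum_congr rfl fun q _ => by ring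

theorem choi_mulVec_single (i : Fin 3) :
    choi (krausForm (kraus y m) 1) *ᵥ Pi.single (i, i) 1 = 0 := by
  ext p
  rw [mulVec_single_one, Matrix.col_apply, choi_krausForm_one]
  refine Finset.sum_eq_zero fun k _ => ?_
  fin_cases i <;> simp [kraus]

theorem krausForm_mem_unitalChannels (hy : y ^ 3 - 12 * y + 12 = 0)
    (hm : m ^ 2 = 2 - y + 2 / 3 * y ^ 2) (h1 : 1.11574 < y) (h2 : y < 1.11576) :
    krausForm (kraus y m) 1 ∈ unitalChannels 3 := by
  refine ⟨⟨isCompletelyPositive_krausForm _ PosSemidef.one, fun ρ => ?_⟩, ?_⟩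
  · rw [krausForm_one_apply, Matrix.trace_sum]
    simp only [Matrix.trace_mul_comm _ (kraus y m _)ᴴ, ← Matrix.mul_assoc]
    rw [← Matrix.trace_sum, ← Finset.sum_mul, sum_conjTranspose_kraus_mul hy hm h1 h2, one_mul]
  · rw [krausForm_one_apply]
    simpa using sum_kraus_mul_conjTranspose hy hm h1 h2

/-- The difference of the Choi matrices is Hermitian, so annihilating the kernel controls rows and
columns alike, and its marginals vanish because both maps are unital channels. Rigidity makes it
zero. -/
theorem eq_krausForm_of_mulVec_eq_zero (hy : y ^ 3 - 12 * y + 12 = 0)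
    (hm : m ^ 2 = 2 - y + 2 / 3 * y ^ 2) (hm0 : m ≠ 0) (h1 : 1.11574 < y) (h2 : y < 1.11576)
    {S : Mat 3 →ₗ[ℂ] Mat 3} (hS : S ∈ unitalChannels 3)
    (hv : ∀ v, choi (krausForm (kraus y m) 1) *ᵥ v = 0 → choi S *ᵥ v = 0) :
    S = krausForm (kraus y m) 1 := by
  have hT := krausForm_mem_unitalChannels hy hm h1 h2
  set T := krausForm (kraus y m) 1 with hTdef
  refine choi_injective (sub_eq_zero.mp ?_)
  have hherm : ∀ p q, (choi S - choi T) p q = star ((choi S - choi T) q p) := by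
    intro p q
    exact (((posSemidef_choi hS.1.1).isHermitian.sub
      (posSemidef_choi hT.1.1).isHermitian).apply p q).symm
  have hker : ∀ v, choi T *ᵥ v = 0 → ∀ p, ∑ q, (choi S - choi T) p q * v q = 0 := by
    intro v h p
    have : (choi S - choi T) *ᵥ v = 0 := by rw [sub_mulVec, hv v h, h, sub_zero]
    exact congrFun this p
  have hz : ∀ p i, (choi S - choi T) p (i, i) = 0 := by
    intro p i
    simpa [Pi.single_apply] using hker _ (choi_mulVec_single i) p
  refine eq_zero_of_marginals_of_kernel hy hm hm0 ?_ hz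
    (fun j => hker _ (choi_mulVec_kernelVec hy j)) ?_ ?_ ?_
  · intro i q
    rw [hherm, hz, star_zero]
  · intro j q
    rw [← star_zero, ← hker _ (choi_mulVec_kernelVec hy j) q, star_sum]
    refine Finset.sum_congr rfl fun p _ => ?_
    rw [hherm p q, star_mul']
  · intro i j
    simp only [Matrix.sub_apply, Finset.sum_sub_distrib, sum_choi_of_trace hS.1.2,
      sum_choi_of_trace hT.1.2, sub_self]
  · intro a b
    simp only [Matrix.sub_apply, Finset.sum_sub_distrib, sum_choi_of_map_one hS.2,
      sum_choi_of_map_one hT.2, sub_self]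

/-- In a convex decomposition the positive summands annihilate the kernel of the sum, so each
component falls under `eq_krausForm_of_mulVec_eq_zero`. -/
theorem krausForm_mem_extremePoints (hy : y ^ 3 - 12 * y + 12 = 0)
    (hm : m ^ 2 = 2 - y + 2 / 3 * y ^ 2) (hm0 : m ≠ 0) (h1 : 1.11574 < y) (h2 : y < 1.11576) :
    krausForm (kraus y m) 1 ∈ Set.extremePoints ℝ (unitalChannels 3) := by
  refine mem_extremePoints.mpr ⟨krausForm_mem_unitalChannels hy hm h1 h2, ?_⟩
  rintro S₁ hS₁ S₂ hS₂ ⟨a, b, ha, hb, -, hab⟩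
  have hp₁ := posSemidef_choi hS₁.1.1
  have hp₂ := posSemidef_choi hS₂.1.1
  constructor
  · refine eq_krausForm_of_mulVec_eq_zero hy hm hm0 h1 h2 hS₁ fun v hv => ?_
    rw [← hab, choi_add, choi_real_smul, choi_real_smul] at hv
    exact mulVec_eq_zero_of_add hp₁ hp₂ ha hb.le hv
  · refine eq_krausForm_of_mulVec_eq_zero hy hm hm0 h1 h2 hS₂ fun v hv => ?_
    rw [← hab, choi_add, choi_real_smul, choi_real_smul, add_comm] at hv
    exact mulVec_eq_zero_of_add hp₂ hp₁ hb ha.le hv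

end Channel

end UnitalChannel

end

open UnitalChannel in
theorem mainTheorem8 :
    ∃ μ₁ μ₂ μ₃ μ₄ : ℝ,
      UnitalChannel.IsSpecialParameters μ₁ μ₂ μ₃ μ₄ ∧
      |μ₁ - 0.21821| < 1 / 10 ^ 5 ∧ |μ₂ - (-0.14937)| < 1 / 10 ^ 5 ∧
      |μ₄ - 0.18595| < 1 / 10 ^ 5 ∧
      (UnitalChannel.matX μ₁ μ₂ μ₃ μ₄).PosSemidef ∧
      (UnitalChannel.matX μ₁ μ₂ μ₃ μ₄).rank = 4 ∧
      ∃ T : UnitalChannel.Mat 3 →ₗ[ℂ] UnitalChannel.Mat 3,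
        T ∈ UnitalChannel.unitalChannels 3 ∧
        UnitalChannel.jamiolkowski T =
          ∑ i, ∑ j, UnitalChannel.matX μ₁ μ₂ μ₃ μ₄ i j •
            UnitalChannel.ketBra (UnitalChannel.psi i) (UnitalChannel.psi j) ∧
        (∃ A : Fin 4 → UnitalChannel.Mat 3,
          UnitalChannel.IsKrausDecomposition T A ∧
          LinearIndependent ℂ A ∧
          LinearIndependent ℂ (fun kl : Fin 4 × Fin 4 =>
            Matrix.fromBlocks ((A kl.1).conjTranspose * A kl.2) 0 0
              (A kl.2 * (A kl.1).conjTranspose))) ∧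
        T ∈ Set.extremePoints ℝ (UnitalChannel.unitalChannels 3) ∧
        T ∉ Set.extremePoints ℝ (UnitalChannel.channels 3) := by
  obtain ⟨y, hy, h1, h2⟩ := exists_cubic_root
  have hr : 0 < 2 - y + 2 / 3 * y ^ 2 := by nlinarith
  obtain ⟨m, hm_def⟩ : ∃ m, m = Real.sqrt (2 - y + 2 / 3 * y ^ 2) := ⟨_, rfl⟩
  have hm0 : m ≠ 0 := hm_def ▸ (Real.sqrt_pos.mpr hr).ne'
  have hm : m ^ 2 = 2 - y + 2 / 3 * y ^ 2 := by rw [hm_def, Real.sq_sqrt hr.le]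
  have hX := sqrtX_mul_conjTranspose hy hm h1 h2
  have hsum := sum_conjTranspose_kraus_mul hy hm h1 h2
  have hli := linearIndependent_kraus hm0 h1 h2
  refine ⟨1 / 6 * m, -(1 - y ^ 2 / 12) / 6, 1 / 6, y / 6, ?_, ?_, abs_mu_two_sub_lt h1 h2,
    abs_mu_four_sub_lt h1 h2, ?_, ?_, krausForm (kraus y m) 1,
    krausForm_mem_unitalChannels hy hm h1 h2, jamiolkowski_krausForm hX,
    ⟨kraus y m, ⟨krausForm_one_apply _, hsum⟩, hli,
      linearIndependent_kraus_products hy hm hm0 h1 h2⟩,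
    krausForm_mem_extremePoints hy hm hm0 h1 h2,
    notMem_extremePoints_channels hli hsum (by simp)⟩
  · rw [hm_def]
    exact isSpecialParameters_of_root hy h1 h2
  · rw [hm_def]
    exact abs_mu_one_sub_lt h1 h2
  · rw [← hX]
    exact Matrix.posSemidef_self_mul_conjTranspose _
  · rw [← hX]
    exact rank_sqrtX_mul_conjTranspose hm0 h1 h2
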